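/- Let $K$ be a field, $d\ge 1$ an integer, $\lambda_1,\dots,\lambda_d\in\mathbb N=\{0,1,2,\dots\}$, and let $e_1,\dots,e_d$ be the standard basis of $\mathbb Z^d$. Let $S=K[y^{(i)}_j \mid 1\le i\le d,\ 1\le j\le\lambda_i]$ be the $\mathbb N^d$-graded polynomial ring with $\deg y^{(i)}_j=e_i$; exponent vectors of monomials of $S$ are elements of $\bigoplus_{i=1}^d\mathbb N^{\lambda_i}$, whose standard unit vectors are denoted $e^{(i)}_j$. Let $A\subset\mathbb N^d$ be a configuration, that is, a finite set for which there is a vector $0\ne c\in\mathbb Q^d$ with $c\cdot a=1$ for all $a\in A$. Let $P_A$ be its toric ideal, the kernel of the $K$-algebra homomorphism $K[x_a\mid a\in A]\to K[z_1,\dots,z_d]$, $x_a\mapsto z^a$. Put $E_i=\{e^{(i)}_1,\dots,e^{(i)}_{\lambda_i}\}$ and let $$A[E_1,\dots,E_d]=\bigl\{e^{(i_1)}_{j_1}+\dots+e^{(i_r)}_{j_r}\ \big|\ r\ge 1,\ i_k\in\{1,\dots,d\},\ 1\le j_k\le\lambda_{i_k},\ e_{i_1}+\dots+e_{i_r}\in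 A\bigr\}$$ be the nested configuration. Let $R=K[x_a\mid a\in A[E_1,\dots,E_d]]$ and let $\phi:R\to S$ be the $K$-algebra homomorphism with $\phi(x_a)=y^a$. A Gröbner basis of an ideal $J$ of a polynomial ring with respect to a term order is a finite subset of $J$ whose initial terms generate the initial ideal of $J$ (the ideal generated by the initial terms of all elements of $J$). It is called quadratic if all its elements have degree at most two, where every variable has degree one. Let $I\subset S$ be an $\mathbb N^d$-graded ideal. If $I$ and $P_A$ admit quadratic Gröbner bases, each with respect to some term order, then the contraction ideal $\phi^{-1}(I)\subset R$ admits a quadratic Gröbner basis with respect to some term order. -/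

import Mathlib

open MvPolynomial

universe u v

noncomputable section

namespace NestedConfig

/-! ### Initial ideals and Groebner bases -/

/-- The initial ideal of `I` with respect to a term order: the ideal generated by the leading terms
of all elements of `I`. -/
def initialIdeal {σ : Type u} {K : Type v} [Field K] (m : MonomialOrder.{u, u} σ)
    (I : Ideal (MvPolynomial σ K)) : Ideal (MvPolynomial σ K) :=
  Ideal.span {t | ∃ f ∈ I, t = m.leadingTerm f}

/-- `G` is a Groebner basis of `I` with respect to a term order: a finite subset of `I` whose
leading terms generate the initial ideal of `I`. -/
def IsGroebnerBasis {σ : Type u} {K : Type v} [Field K] (m : MonomialOrder.{u, u} σ)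
    (G : Set (MvPolynomial σ K)) (I : Ideal (MvPolynomial σ K)) : Prop :=
  G.Finite ∧ G ⊆ (I : Set (MvPolynomial σ K)) ∧
    Ideal.span (m.leadingTerm '' G) = initialIdeal m I

/-- `I` admits, with respect to some term order, a quadratic Groebner basis, that is, one all of
whose elements have degree at most two. -/
def AdmitsQuadraticGroebnerBasis {σ : Type u} {K : Type v} [Field K]
    (I : Ideal (MvPolynomial σ K)) : Prop :=
  ∃ (m : MonomialOrder.{u, u} σ) (G : Set (MvPolynomial σ K)),
    IsGroebnerBasis m G I ∧ ∀ g ∈ G, g.totalDegree ≤ 2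

/-! ### Monomial homomorphisms, toric ideals and configurations -/

/-- The monomial homomorphism `K[x_a | a ∈ A] → K[σ]` that sends `x_a` to the monomial with
exponent vector `a`. -/
def monomialHom {σ : Type u} (K : Type v) [Field K] (A : Set (σ →₀ ℕ)) :
    MvPolynomial A K →ₐ[K] MvPolynomial σ K :=
  aeval fun a : A => monomial (a : σ →₀ ℕ) (1 : K)

/-- The toric ideal of `A`: the kernel of the monomial homomorphism of `A`. -/
def toricIdeal {σ : Type u} (K : Type v) [Field K] (A : Set (σ →₀ ℕ)) :
    Ideal (MvPolynomial A K) :=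
  RingHom.ker (monomialHom K A)

/-- A finite set `A` of vectors in `ℕ^d` is a configuration if some nonzero rational vector `c`
satisfies `c · a = 1` for all `a` in `A`. -/
def IsConfiguration {d : ℕ} (A : Set (Fin d →₀ ℕ)) : Prop :=
  A.Finite ∧ ∃ c : Fin d → ℚ, c ≠ 0 ∧ ∀ a ∈ A, ∑ i, c i * (a i : ℚ) = 1

/-- The nested configuration `A[B_1, …, B_d]` with `B_i = {b i j | j ∈ [l i]}`: all sums
`b i_1 j_1 + ⋯ + b i_r j_r` with `r ≥ 1` and `e_{i_1} + ⋯ + e_{i_r} ∈ A`. -/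
def nestedConfiguration {d : ℕ} {l : Fin d → ℕ} {M : Type*} [AddCommMonoid M]
    (A : Set (Fin d →₀ ℕ)) (b : (i : Fin d) → Fin (l i) → M) : Set M :=
  {v | ∃ (r : ℕ) (i : Fin r → Fin d) (j : (k : Fin r) → Fin (l (i k))),
    1 ≤ r ∧ (∑ k, Finsupp.single (i k) 1) ∈ A ∧ v = ∑ k, b (i k) (j k)}

/-! ### The multigraded polynomial ring `S = K[y^{(i)}_j | i ∈ [d], j ∈ [l i]]` -/

/-- The index set of the variables `y^{(i)}_j`, `i ∈ [d]`, `j ∈ [l i]`. -/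
abbrev Var {d : ℕ} (l : Fin d → ℕ) : Type := (i : Fin d) × Fin (l i)

/-- The unit vectors `e^{(i)}_j`; `E_i` is the set of all `e^{(i)}_j` with `j ∈ [l i]`. -/
def unitVec {d : ℕ} (l : Fin d → ℕ) (i : Fin d) (j : Fin (l i)) : Var l →₀ ℕ :=
  Finsupp.single ⟨i, j⟩ 1

/-- The `ℕ^d`-degree of the variables: `deg y^{(i)}_j = e_i`. -/
def varDegree {d : ℕ} (l : Fin d → ℕ) (p : Var l) : Fin d →₀ ℕ :=
  Finsupp.single p.1 1

/-- `I` is an `ℕ^d`-graded ideal of `S`: it contains every `ℕ^d`-homogeneous component of each of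
its elements. -/
def IsMultigraded {d : ℕ} {l : Fin d → ℕ} {K : Type v} [Field K]
    (I : Ideal (MvPolynomial (Var l) K)) : Prop :=
  ∀ f ∈ I, ∀ n : Fin d →₀ ℕ, weightedHomogeneousComponent (varDegree l) n f ∈ I

end NestedConfig

end

noncomputable section

namespace NestedConfig

open scoped MonomialOrder

/-! Monomials of `R` are factorizations of monomials of `S`, and the shape of a factorization
records the multidegrees of its factors, so it is a monomial of `K[x_a | a ∈ A]`. The term order on
`R` compares products by the order for `I`, then shapes by the order for `P_A`, then a weight that
favours sorted factorizations. It suffices that the leading monomial `s` of every nonzero `f` in the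
contraction is divisible by the leading monomial of an element of degree at most two.

If the coefficient of `φ(f)` at the product of `s` vanishes, another term of `f` has the same
product, so `s` is not minimal in its fibre. If no part of `s` of degree at most two could be
improved, its shape would be minimal for `P_A` and its factors pairwise sorted. Such a factorization
is unique in its fibre (`eq_of_isSorted`), hence equal to the minimal one, a contradiction. The
improvable part gives a quadratic binomial in `ker φ` (`exists_order_hasSmallerPart`).

Otherwise the product of `s` is the leading monomial of `φ(f)`, and some `g` in the basis of `I` has
a leading monomial dividing it. That divisor already divides a product of at most two factors of
`s`. Multiplying a multihomogeneous component of `g` up to that product and lifting it term by term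
with constant shape gives the required element (`exists_mem_comap_of_degree_eq`). -/

/-! ### Refining a term order by an additive map -/

section Refine

variable {σ : Type u} {P : Type*} [AddCommMonoid P] [LinearOrder P] (f : (σ →₀ ℕ) →+ P)
  (m : MonomialOrder.{u, u} σ)

/-- Exponent vectors, to be ordered by an additive map first and by `m` next. -/
def RefineSyn (_ : (σ →₀ ℕ) →+ P) (_ : MonomialOrder.{u, u} σ) : Type u := σ →₀ ℕ

instance : AddCommMonoid (RefineSyn f m) := inferInstanceAs (AddCommMonoid (σ →₀ ℕ))

/-- An exponent vector, as an element of the refined order. -/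
def toRefineSyn : (σ →₀ ℕ) ≃+ RefineSyn f m := AddEquiv.refl _

instance : LinearOrder (RefineSyn f m) :=
  LinearOrder.lift' (fun c => (toLex (f ((toRefineSyn f m).symm c),
    m.toSyn ((toRefineSyn f m).symm c)) : P ×ₗ m.syn)) fun c d h => by
    have := congrArg (fun x => (ofLex x).2) h
    exact (toRefineSyn f m).symm.injective (m.toSyn.injective this)

theorem toRefineSyn_le_iff (c d : σ →₀ ℕ) :
    toRefineSyn f m c ≤ toRefineSyn f m d ↔ f c < f d ∨ f c = f d ∧ c ≼[m] d :=
  Prod.Lex.toLex_le_toLex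

/-- The term order that compares the values of an additive map first and breaks ties by `m`. -/
def refineOrder [IsOrderedCancelAddMonoid P] [WellFoundedLT P] (hf : ∀ c, 0 ≤ f c) :
    MonomialOrder.{u, u} σ where
  syn := RefineSyn f m
  isOrderedAddMonoid_syn :=
    { add_le_add_left := fun a b h c => by
        obtain ⟨a, rfl⟩ := (toRefineSyn f m).surjective a
        obtain ⟨b, rfl⟩ := (toRefineSyn f m).surjective b
        obtain ⟨c, rfl⟩ := (toRefineSyn f m).surjective c
        rw [← map_add, ← map_add]
        rw [toRefineSyn_le_iff] at h ⊢
        simpa using h }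
  toSyn := toRefineSyn f m
  toSyn_monotone := fun c d h => by
    rw [toRefineSyn_le_iff]
    obtain ⟨e, rfl⟩ := exists_add_of_le h
    rcases (hf e).lt_or_eq with h0 | h0
    · exact Or.inl (by simpa using h0)
    · exact Or.inr ⟨by simp [← h0], m.toSyn_monotone h⟩
  wellFoundedLT_syn := ⟨InvImage.wf (fun c => (toLex (f ((toRefineSyn f m).symm c),
    m.toSyn ((toRefineSyn f m).symm c)) : P ×ₗ m.syn)) wellFounded_lt⟩

theorem refineOrder_lt_iff [IsOrderedCancelAddMonoid P] [WellFoundedLT P] (hf : ∀ c, 0 ≤ f c)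
    (c d : σ →₀ ℕ) : c ≺[refineOrder f m hf] d ↔ f c < f d ∨ f c = f d ∧ c ≺[m] d :=
  Prod.Lex.toLex_lt_toLex

end Refine

/-- A finite set of variables has a term order. -/
def someOrder (σ : Type u) [Finite σ] : MonomialOrder.{u, u} σ :=
  letI : LinearOrder σ :=
    haveI := Classical.decRel (WellOrderingRel (α := σ))
    linearOrderOfSTO (WellOrderingRel (α := σ))
  haveI : WellFoundedGT σ := Finite.to_wellFoundedGT
  MonomialOrder.lex

/-! ### Quadratic Groebner bases in terms of exponent vectors -/

section Criterion

variable {σ : Type u} {K : Type v} [Field K]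

theorem degree_le_totalDegree {f : MvPolynomial σ K} {e : σ →₀ ℕ} (he : e ∈ f.support) :
    e.degree ≤ f.totalDegree :=
  le_totalDegree he

/-- Every nonzero element of an ideal has a leading monomial divisible by the leading monomial of
some element of a Groebner basis. -/
theorem IsGroebnerBasis.exists_degree_le {m : MonomialOrder.{u, u} σ}
    {G : Set (MvPolynomial σ K)} {I : Ideal (MvPolynomial σ K)} (hG : IsGroebnerBasis m G I)
    {f : MvPolynomial σ K} (hf : f ∈ I) (hf0 : f ≠ 0) :
    ∃ g ∈ G, g ≠ 0 ∧ m.degree g ≤ m.degree f := by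
  have h : m.leadingTerm f ∈ Ideal.span (m.leadingTerm '' G) := by
    rw [hG.2.2]
    exact Ideal.subset_span ⟨f, hf, rfl⟩
  -- Leading coefficients of nonzero elements are units, so the span is a monomial ideal, where
  -- membership means divisibility by a generator.
  rw [MonomialOrder.span_leadingTerm_eq_span_monomial'] at h
  have e : (fun p : MvPolynomial σ K => monomial (m.degree p) (1 : K)) '' (G \ {0}) =
      (fun s => monomial s (1 : K)) '' (m.degree '' (G \ {0})) := by
    rw [Set.image_image]
  rw [e, mem_ideal_span_monomial_image] at h
  obtain ⟨s, ⟨g, hg, rfl⟩, hs⟩ := h (m.degree f) (by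
    rw [MonomialOrder.support_leadingTerm' hf0]; simp)
  exact ⟨g, hg.1, hg.2, hs⟩

/-- An ideal has a quadratic Groebner basis as soon as every leading monomial is divisible by the
leading monomial of an element of degree at most two. -/
theorem admitsQuadraticGroebnerBasis_of_forall [Finite σ] (m : MonomialOrder.{u, u} σ)
    (I : Ideal (MvPolynomial σ K))
    (h : ∀ f ∈ I, f ≠ 0 → ∃ g ∈ I, g ≠ 0 ∧ g.totalDegree ≤ 2 ∧ m.degree g ≤ m.degree f) :
    AdmitsQuadraticGroebnerBasis I := by
  classical
  let Q : (σ →₀ ℕ) → MvPolynomial σ K → Prop := fun e g =>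
    g ∈ I ∧ g ≠ 0 ∧ g.totalDegree ≤ 2 ∧ m.degree g = e
  -- One element per attainable leading exponent; only finitely many exponents have degree at most
  -- two. The default 0 is harmless in the basis.
  let F : (σ →₀ ℕ) → MvPolynomial σ K := fun e => if H : ∃ g, Q e g then H.choose else 0
  have hF : ∀ e, F e ∈ I ∧ (F e).totalDegree ≤ 2 := fun e => by
    by_cases H : ∃ g, Q e g
    · simp only [F, dif_pos H]
      exact ⟨H.choose_spec.1, H.choose_spec.2.2.1⟩
    · simp [F, dif_neg H]
  refine ⟨m, F '' {e | e.degree ≤ 2}, ⟨(Finsupp.finite_of_degree_le 2).image _, ?_, ?_⟩, ?_⟩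
  · rintro _ ⟨e, -, rfl⟩
    exact (hF e).1
  · apply le_antisymm
    · refine Ideal.span_mono ?_
      rintro _ ⟨_, ⟨e, -, rfl⟩, rfl⟩
      exact ⟨_, (hF e).1, rfl⟩
    · refine Ideal.span_le.2 ?_
      rintro _ ⟨f, hf, rfl⟩
      by_cases hf0 : f = 0
      · simp [hf0]
      obtain ⟨g, hgI, hg0, hg2, hgd⟩ := h f hf hf0
      have H : ∃ g', Q (m.degree g) g' := ⟨g, hgI, hg0, hg2, rfl⟩
      have hFe : F (m.degree g) = H.choose := dif_pos H
      have hs := H.choose_spec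
      rw [← hFe] at hs
      have hmem : m.leadingTerm (F (m.degree g)) ∈
          Ideal.span (m.leadingTerm '' (F '' {e | e.degree ≤ 2})) :=
        Ideal.subset_span ⟨_, ⟨_, (degree_le_totalDegree (m.degree_mem_support hg0)).trans hg2,
          rfl⟩, rfl⟩
      refine Ideal.mem_of_dvd _ ?_ hmem
      rw [MonomialOrder.leadingTerm, MonomialOrder.leadingTerm, monomial_dvd_monomial]
      refine ⟨Or.inr ?_, ?_⟩
      · rw [hs.2.2.2]; exact hgd
      · exact (isUnit_iff_ne_zero.2 (m.leadingCoeff_ne_zero_iff.2 hs.2.1)).dvd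
  · rintro _ ⟨e, -, rfl⟩
    exact (hF e).2

end Criterion

/-! ### Monomial homomorphisms on exponent vectors -/

section MonomialHom

variable {σ : Type u} {K : Type v} [Field K] {A : Set (σ →₀ ℕ)}

/-- The effect of the monomial homomorphism on exponent vectors. -/
def expHom (A : Set (σ →₀ ℕ)) : (A →₀ ℕ) →+ (σ →₀ ℕ) :=
  Finsupp.weight Subtype.val

@[simp]
theorem expHom_single (a : A) (n : ℕ) : expHom A (Finsupp.single a n) = n • (a : σ →₀ ℕ) :=
  Finsupp.weight_single _ _ _

theorem monomialHom_monomial (e : A →₀ ℕ) (c : K) :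
    monomialHom K A (monomial e c) = monomial (expHom A e) c := by
  induction e using Finsupp.induction_linear generalizing c with
  | zero => simp [monomialHom, algebraMap_eq]
  | add e f he hf =>
    rw [← one_mul c, ← monomial_mul, map_mul, he, hf, monomial_mul, map_add]
  | single a n =>
    rw [monomialHom, aeval_monomial, Finsupp.prod_single_index (by simp), monomial_pow,
      algebraMap_eq, C_mul_monomial, expHom_single, one_pow, mul_one]

theorem coeff_monomialHom [DecidableEq (σ →₀ ℕ)] (f : MvPolynomial A K) (e : σ →₀ ℕ) :
    coeff e (monomialHom K A f) = ∑ s ∈ f.support with expHom A s = e, coeff s f := by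
  classical
  conv_lhs => rw [f.as_sum, map_sum, coeff_sum]
  simp only [monomialHom_monomial, coeff_monomial, Finset.sum_filter]
  congr!

/-- A term that cancels under the monomial homomorphism shares its image with another term. -/
theorem exists_ne_of_coeff_monomialHom_eq_zero {f : MvPolynomial A K} {s : A →₀ ℕ}
    (hs : s ∈ f.support) (h : coeff (expHom A s) (monomialHom K A f) = 0) :
    ∃ t ∈ f.support, t ≠ s ∧ expHom A t = expHom A s := by
  classical
  by_contra! H
  rw [coeff_monomialHom, Finset.sum_eq_single_of_mem s (by simpa using hs)] at h
  · exact (mem_support_iff.1 hs) h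
  · intro t ht hts
    rw [Finset.mem_filter] at ht
    exact absurd ht.2 (H t ht.1 hts)

theorem exists_of_coeff_monomialHom_ne_zero {f : MvPolynomial A K} {e : σ →₀ ℕ}
    (h : e ∈ (monomialHom K A f).support) : ∃ t ∈ f.support, expHom A t = e := by
  classical
  rw [mem_support_iff, coeff_monomialHom] at h
  obtain ⟨t, ht, -⟩ := Finset.exists_ne_zero_of_sum_ne_zero h
  exact ⟨t, (Finset.mem_filter.1 ht).1, (Finset.mem_filter.1 ht).2⟩

/-- If a toric ideal has a quadratic Groebner basis, then every exponent vector that is not minimal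
in its fibre has a part of degree at most two that is not minimal in its fibre either. -/
theorem exists_order_of_toricIdeal (h : AdmitsQuadraticGroebnerBasis (toricIdeal K A)) :
    ∃ m : MonomialOrder.{u, u} A, ∀ s t : A →₀ ℕ, expHom A s = expHom A t → t ≺[m] s →
      ∃ e e' : A →₀ ℕ, e ≤ s ∧ e.degree ≤ 2 ∧ e'.degree ≤ 2 ∧ expHom A e' = expHom A e ∧
        e' ≺[m] e := by
  obtain ⟨m, G, hG, hG2⟩ := h
  refine ⟨m, fun s t hst hlt => ?_⟩
  have hts : t ≠ s := by rintro rfl; exact lt_irrefl _ hlt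
  set f : MvPolynomial A K := monomial s 1 - monomial t 1 with hf
  classical
  have hdeg : m.degree f = s := by
    rw [hf, MonomialOrder.degree_sub_of_lt] <;> simp [MonomialOrder.degree_monomial, hlt]
  have hf0 : f ≠ 0 := by
    intro h0
    have := congrArg (coeff s) h0
    simp [hf, coeff_monomial, hts] at this
  have hfI : f ∈ toricIdeal K A := by
    simp [toricIdeal, RingHom.mem_ker, hf, monomialHom_monomial, hst]
  obtain ⟨g, hg, hg0, hgd⟩ := hG.exists_degree_le hfI hf0
  have hgI : monomialHom K A g = 0 := hG.2.1 hg
  have hgs := m.degree_mem_support hg0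
  obtain ⟨e', he', hne, heq⟩ := exists_ne_of_coeff_monomialHom_eq_zero hgs (by simp [hgI])
  refine ⟨m.degree g, e', hdeg ▸ hgd, (degree_le_totalDegree hgs).trans (hG2 g hg),
    (degree_le_totalDegree he').trans (hG2 g hg), heq, ?_⟩
  exact lt_of_le_of_ne (m.le_degree he') (fun h => hne (m.toSyn.injective h))

end MonomialHom

/-! ### Splitting exponent vectors -/

section Split

theorem finsupp_induction_single_one {σ : Type*} {p : (σ →₀ ℕ) → Prop} (f : σ →₀ ℕ) (zero : p 0)
    (add : ∀ f a, p f → p (f + Finsupp.single a 1)) : p f := by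
  have key : ∀ (a : σ) (n : ℕ) (f : σ →₀ ℕ), p f → p (f + Finsupp.single a n) := by
    intro a n
    induction n with
    | zero => intro f hf; simpa using hf
    | succ n ih =>
      intro f hf
      rw [Finsupp.single_add, ← add_assoc]
      exact add _ _ (ih f hf)
  induction f using Finsupp.induction with
  | zero => exact zero
  | single_add a n f _ _ hf =>
    rw [add_comm]
    exact key a n f hf

theorem exists_of_mapDomain_ne_zero {σ τ : Type*} {g : σ → τ} {s : σ →₀ ℕ} {t : τ}
    (h : Finsupp.mapDomain g s t ≠ 0) : ∃ a, s a ≠ 0 ∧ g a = t := by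
  classical
  have := Finsupp.mapDomain_support (Finsupp.mem_support_iff.2 h)
  obtain ⟨a, ha, rfl⟩ := Finset.mem_image.1 this
  exact ⟨a, Finsupp.mem_support_iff.1 ha, rfl⟩

/-- A part of the image of an exponent vector is the image of a part. -/
theorem exists_le_mapDomain_eq {σ τ : Type*} {g : σ → τ} {s : σ →₀ ℕ} (e : τ →₀ ℕ)
    (h : e ≤ Finsupp.mapDomain g s) : ∃ s' ≤ s, Finsupp.mapDomain g s' = e := by
  induction e using finsupp_induction_single_one with
  | zero => exact ⟨0, zero_le, Finsupp.mapDomain_zero⟩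
  | add e a ih =>
    obtain ⟨s₀, hs₀, rfl⟩ := ih (le_self_add.trans h)
    obtain ⟨r, rfl⟩ := exists_add_of_le hs₀
    rw [Finsupp.mapDomain_add, add_le_add_iff_left] at h
    have ha : Finsupp.mapDomain g r a ≠ 0 := by
      have := h a
      simp only [Finsupp.single_eq_same] at this
      omega
    obtain ⟨b, hb, rfl⟩ := exists_of_mapDomain_ne_zero ha
    refine ⟨s₀ + Finsupp.single b 1, ?_, by simp [Finsupp.mapDomain_add]⟩
    simpa using Nat.one_le_iff_ne_zero.2 hb

theorem exists_of_expHom_ne_zero {σ : Type*} {B : Set (σ →₀ ℕ)} {s : B →₀ ℕ} {x : σ}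
    (h : expHom B s x ≠ 0) : ∃ b : B, s b ≠ 0 ∧ (b : σ →₀ ℕ) x ≠ 0 := by
  rw [expHom, Finsupp.weight_apply, Finsupp.sum, Finsupp.finsetSum_apply] at h
  obtain ⟨b, -, hb⟩ := Finset.exists_ne_zero_of_sum_ne_zero h
  rw [Finsupp.smul_apply, smul_ne_zero_iff] at hb
  exact ⟨b, hb⟩

/-- A divisor of degree `n` of a product of monomials divides the product of some `n` factors. -/
theorem exists_le_expHom_of_le {σ : Type*} {B : Set (σ →₀ ℕ)} {s : B →₀ ℕ} (p : σ →₀ ℕ)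
    (h : p ≤ expHom B s) : ∃ s' ≤ s, s'.degree ≤ p.degree ∧ p ≤ expHom B s' := by
  induction p using finsupp_induction_single_one with
  | zero => exact ⟨0, zero_le, by simp, zero_le⟩
  | add p x ih =>
    obtain ⟨s₀, hs₀, hd, hp⟩ := ih (le_self_add.trans h)
    by_cases hx : p + Finsupp.single x 1 ≤ expHom B s₀
    · exact ⟨s₀, hs₀, by rw [map_add]; omega, hx⟩
    obtain ⟨r, rfl⟩ := exists_add_of_le hs₀
    obtain ⟨q, hq⟩ := exists_add_of_le hp
    rw [hq, add_le_add_iff_left, Finsupp.single_le_iff] at hx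
    rw [map_add, hq, add_assoc, add_le_add_iff_left, Finsupp.single_le_iff,
      Finsupp.add_apply] at h
    obtain ⟨b, hb, hbx⟩ := exists_of_expHom_ne_zero (s := r) (x := x) (by omega)
    refine ⟨s₀ + Finsupp.single b 1, ?_, by simpa using hd, ?_⟩
    · simpa using Nat.one_le_iff_ne_zero.2 hb
    · rw [map_add, expHom_single, one_smul]
      exact add_le_add hp (Finsupp.single_le_iff.2 (Nat.one_le_iff_ne_zero.2 hbx))

end Split

/-! ### The multidegree and nested configurations of unit vectors -/

section Multidegree

variable {d : ℕ} {l : Fin d → ℕ} {A : Set (Fin d →₀ ℕ)}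

/-- The `ℕ^d`-degree of an exponent vector. -/
def mdeg (l : Fin d → ℕ) : (Var l →₀ ℕ) →+ (Fin d →₀ ℕ) :=
  Finsupp.mapDomain.addMonoidHom Sigma.fst

@[simp]
theorem mdeg_single (p : Var l) (n : ℕ) : mdeg l (Finsupp.single p n) = Finsupp.single p.1 n :=
  Finsupp.mapDomain_single

theorem weight_varDegree (s : Var l →₀ ℕ) : Finsupp.weight (varDegree l) s = mdeg l s := by
  revert s
  rw [← DFunLike.ext_iff]
  refine Finsupp.addHom_ext fun p n => ?_
  simp [Finsupp.weight_single, varDegree]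

theorem mdeg_apply (s : Var l →₀ ℕ) (i : Fin d) : mdeg l s i = ∑ j, s ⟨i, j⟩ := by
  induction s using Finsupp.induction_linear with
  | zero => simp
  | add s t hs ht => simp [hs, ht, Finset.sum_add_distrib]
  | single p n =>
    obtain ⟨i', j'⟩ := p
    rw [mdeg_single]
    by_cases h : i' = i
    · subst h
      rw [Finset.sum_eq_single j']
      · simp
      · intro j _ hj
        exact Finsupp.single_eq_of_ne (by simpa using hj)
      · simp
    · rw [Finsupp.single_eq_of_ne (Ne.symm h), Finset.sum_eq_zero]
      intro j _
      exact Finsupp.single_eq_of_ne (by simp [Ne.symm h])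

theorem degree_mapDomain {σ τ : Type*} (g : σ → τ) (s : σ →₀ ℕ) :
    (Finsupp.mapDomain g s).degree = s.degree := by
  induction s using Finsupp.induction_linear with
  | zero => simp
  | add s t hs ht => simp [Finsupp.mapDomain_add, hs, ht]
  | single p n => simp

theorem IsConfiguration.zero_notMem (hA : IsConfiguration A) : 0 ∉ A := by
  obtain ⟨-, c, -, h⟩ := hA
  intro h0
  simpa using h 0 h0

theorem exists_list_sum (s : Var l →₀ ℕ) :
    ∃ L : List (Var l), (L.map fun p => Finsupp.single p 1).sum = s := by
  induction s using finsupp_induction_single_one with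
  | zero => exact ⟨[], rfl⟩
  | add s p ih =>
    obtain ⟨L, rfl⟩ := ih
    exact ⟨p :: L, by simp [add_comm]⟩

/-- The nested configuration of unit vectors consists of all vectors whose multidegree is in `A`. -/
theorem mem_nestedConfiguration (h0 : 0 ∉ A) (s : Var l →₀ ℕ) :
    s ∈ nestedConfiguration A (unitVec l) ↔ mdeg l s ∈ A := by
  constructor
  · rintro ⟨r, i, j, -, h, rfl⟩
    simpa [unitVec] using h
  · intro h
    obtain ⟨L, rfl⟩ := exists_list_sum s
    have hs : ∀ {M : Type} [AddCommMonoid M] (g : Var l → M),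
        ∑ k : Fin L.length, g (L.get k) = (L.map g).sum := fun g => by
      rw [← List.sum_ofFn, ← Function.comp_def, ← List.map_ofFn, List.ofFn_get]
    refine ⟨L.length, fun k => (L.get k).1, fun k => (L.get k).2, ?_, ?_, ?_⟩
    -- An empty sum would have multidegree 0, which is not in `A`.
    · rw [Nat.one_le_iff_ne_zero]
      intro hL
      rw [List.length_eq_zero_iff] at hL
      exact h0 (by simpa [hL] using h)
    · rw [map_list_sum, List.map_map] at h
      rw [hs (fun p => Finsupp.single p.1 1)]
      simpa [Function.comp_def] using h
    · exact (hs (fun p => Finsupp.single p 1)).symm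

theorem finite_nestedConfiguration (hA : IsConfiguration A) :
    (nestedConfiguration A (unitVec l)).Finite := by
  obtain ⟨n, hn⟩ := (hA.1.image Finsupp.degree).bddAbove
  refine (Finsupp.finite_of_degree_le n).subset fun s hs => ?_
  rw [mem_nestedConfiguration hA.zero_notMem] at hs
  have := hn ⟨_, hs, rfl⟩
  rwa [mdeg, Finsupp.mapDomain.addMonoidHom_apply, degree_mapDomain] at this

variable (h0 : 0 ∉ A)

/-- The multidegree of an element of the nested configuration. -/
def shapeOf (b : nestedConfiguration A (unitVec l)) : A :=
  ⟨mdeg l b, (mem_nestedConfiguration h0 _).1 b.2⟩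

/-- The homomorphism on exponent vectors that replaces each factor by its multidegree. -/
def shape : (nestedConfiguration A (unitVec l) →₀ ℕ) →+ (A →₀ ℕ) :=
  Finsupp.mapDomain.addMonoidHom (shapeOf h0)

@[simp]
theorem shape_single (b : nestedConfiguration A (unitVec l)) (n : ℕ) :
    shape h0 (Finsupp.single b n) = Finsupp.single (shapeOf h0 b) n :=
  Finsupp.mapDomain_single

theorem degree_shape (s : nestedConfiguration A (unitVec l) →₀ ℕ) :
    (shape h0 s).degree = s.degree :=
  degree_mapDomain _ _

theorem mdeg_expHom (s : nestedConfiguration A (unitVec l) →₀ ℕ) :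
    mdeg l (expHom _ s) = expHom A (shape h0 s) := by
  induction s using Finsupp.induction_linear with
  | zero => simp
  | add s t hs ht => simp only [map_add, hs, ht]
  | single b n => rw [shape_single, expHom_single, expHom_single, map_nsmul]; rfl

/-- A monomial whose multidegree is a sum of elements of `A` factors accordingly. -/
theorem exists_shape_eq (e : A →₀ ℕ) (U : Var l →₀ ℕ) (h : mdeg l U = expHom A e) :
    ∃ s, shape (l := l) h0 s = e ∧ expHom _ s = U := by
  induction e using finsupp_induction_single_one generalizing U with
  | zero =>
    refine ⟨0, map_zero _, ?_⟩
    rw [map_zero] at h ⊢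
    rw [eq_comm, ← Finsupp.degree_eq_zero_iff, ← degree_mapDomain Sigma.fst]
    exact (Finsupp.degree_eq_zero_iff _).2 h
  | add e a ih =>
    rw [map_add, expHom_single, one_smul] at h
    -- Split off a part of multidegree `expHom A e`; the remainder has multidegree `a`, so it is
    -- itself a factor.
    obtain ⟨V, hV, hVe⟩ := exists_le_mapDomain_eq (g := Sigma.fst) (s := U) (expHom A e)
      (le_self_add.trans h.ge)
    obtain ⟨W, rfl⟩ := exists_add_of_le hV
    obtain ⟨s, rfl, rfl⟩ := ih V hVe
    have hW : mdeg l W = a := by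
      rw [map_add, ← hVe] at h
      exact add_left_cancel h
    have hWB : W ∈ nestedConfiguration A (unitVec l) := by
      rw [mem_nestedConfiguration h0, hW]; exact a.2
    refine ⟨s + Finsupp.single ⟨W, hWB⟩ 1, ?_, by simp⟩
    rw [map_add, shape_single]
    congr 2
    exact Subtype.ext hW

end Multidegree

/-! ### Sorted factorizations -/

section Sorted

variable {d : ℕ} {l : Fin d → ℕ} {A : Set (Fin d →₀ ℕ)}

/-- Every variable of `s` precedes every variable of `t` of the same multidegree. -/
def Precedes (s t : Var l →₀ ℕ) : Prop :=
  ∀ p q : Var l, p.1 = q.1 → s p ≠ 0 → t q ≠ 0 → (p.2 : ℕ) ≤ q.2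

/-- If `s` exceeds `s'` at `(i, j)`, equal multidegrees force `s'` to exceed `s` at some `(i, k)`.
Then `x'` is nonzero at `(i, j)` and `x` at `(i, k)`, so the two precedence conditions give `j ≤ k`
and `k ≤ j`, which is absurd. -/
theorem le_of_precedes {s s' x x' : Var l →₀ ℕ} (h : s + x = s' + x') (hd : mdeg l s = mdeg l s')
    (hx : Precedes s x) (hx' : Precedes s' x') : s ≤ s' := by
  rintro ⟨i, j⟩
  by_contra! hlt
  obtain ⟨k, hk⟩ : ∃ k, s ⟨i, k⟩ < s' ⟨i, k⟩ := by
    by_contra! H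
    have h1 := congrArg (fun f : Fin d →₀ ℕ => f i) hd
    simp only [mdeg_apply] at h1
    exact (Finset.sum_lt_sum (fun k _ => H k) ⟨j, Finset.mem_univ _, hlt⟩).ne' h1
  have hj := congrArg (fun f : Var l →₀ ℕ => f ⟨i, j⟩) h
  have hk' := congrArg (fun f : Var l →₀ ℕ => f ⟨i, k⟩) h
  simp only [Finsupp.add_apply] at hj hk'
  have h1 := hx ⟨i, j⟩ ⟨i, k⟩ rfl (by omega) (by omega)
  have h2 := hx' ⟨i, k⟩ ⟨i, j⟩ rfl (by omega) (by omega)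
  have : j = k := Fin.ext (le_antisymm h1 h2)
  subst this
  omega

/-- A vector that precedes its complement is determined by its multidegree. -/
theorem eq_of_precedes {s s' x x' : Var l →₀ ℕ} (h : s + x = s' + x') (hd : mdeg l s = mdeg l s')
    (hx : Precedes s x) (hx' : Precedes s' x') : s = s' :=
  le_antisymm (le_of_precedes h hd hx hx') (le_of_precedes h.symm hd.symm hx' hx)

/-- Any two factors of `s` are sorted, in the order given by `T`. -/
def IsSorted {B : Set (Var l →₀ ℕ)} (T : B → ℕ) (s : B →₀ ℕ) : Prop :=
  ∀ a b : B, Finsupp.single a 1 + Finsupp.single b 1 ≤ s → T a ≤ T b →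
    Precedes (a : Var l →₀ ℕ) b

theorem IsSorted.mono {B : Set (Var l →₀ ℕ)} {T : B → ℕ} {s t : B →₀ ℕ} (ht : IsSorted T t)
    (h : s ≤ t) : IsSorted T s :=
  fun a b hab => ht a b (hab.trans h)

/-- Precedence is tested on pairs of variables, and each variable of the product of `r` occurs in a
single factor, so pairwise sortedness suffices. -/
theorem IsSorted.precedes {B : Set (Var l →₀ ℕ)} {T : B → ℕ} {a : B} {r : B →₀ ℕ}
    (h : IsSorted T (Finsupp.single a 1 + r)) (ha : ∀ b, r b ≠ 0 → T a ≤ T b) :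
    Precedes (a : Var l →₀ ℕ) (expHom B r) := by
  intro p q hpq hp hq
  obtain ⟨b, hb, hbq⟩ := exists_of_expHom_ne_zero hq
  refine h a b ?_ (ha b hb) p q hpq hp hbq
  rw [add_le_add_iff_left, Finsupp.single_le_iff]
  exact Nat.one_le_iff_ne_zero.2 hb

theorem exists_eq_single_add {B : Type*} (T : B → ℕ) {s : B →₀ ℕ} (hs : s ≠ 0) :
    ∃ a r, s = Finsupp.single a 1 + r ∧ ∀ b, s b ≠ 0 → T a ≤ T b := by
  obtain ⟨a, ha, hmin⟩ := s.support.exists_min_image T (Finsupp.support_nonempty_iff.2 hs)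
  have hle : Finsupp.single a 1 ≤ s :=
    Finsupp.single_le_iff.2 (Nat.one_le_iff_ne_zero.2 (Finsupp.mem_support_iff.1 ha))
  obtain ⟨r, hr⟩ := exists_add_of_le hle
  exact ⟨a, r, hr, fun b hb => hmin b (Finsupp.mem_support_iff.2 hb)⟩

variable (h0 : 0 ∉ A)

/-- A sorted factorization is determined by its product and the multidegrees of its factors. -/
theorem eq_of_isSorted {T : nestedConfiguration A (unitVec l) → ℕ} {rank : A → ℕ}
    (hr : Function.Injective rank)
    (hT : ∀ a b, T a ≤ T b → rank (shapeOf h0 a) ≤ rank (shapeOf h0 b)) (n : ℕ)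
    (s t : nestedConfiguration A (unitVec l) →₀ ℕ) (hn : s.degree = n)
    (hs : IsSorted T s) (ht : IsSorted T t) (hshape : shape h0 s = shape h0 t)
    (hexp : expHom _ s = expHom _ t) : s = t := by
  induction n generalizing s t with
  | zero =>
    have h2 : t.degree = 0 := by rw [← degree_shape h0, ← hshape, degree_shape, hn]
    rw [(Finsupp.degree_eq_zero_iff _).1 hn, (Finsupp.degree_eq_zero_iff _).1 h2]
  | succ n ih =>
    have htn : t.degree = n + 1 := by rw [← degree_shape h0, ← hshape, degree_shape, hn]
    obtain ⟨a, r, rfl, ha⟩ := exists_eq_single_add T (s := s) (by rintro rfl; simp at hn)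
    obtain ⟨b, r', rfl, hb⟩ := exists_eq_single_add T (s := t) (by rintro rfl; simp at htn)
    -- A `T`-least factor realizes the least rank in the shape, so equal shapes give the two least
    -- factors the same multidegree.
    have key : ∀ (a b : nestedConfiguration A (unitVec l)) (r r' : nestedConfiguration A (unitVec l) →₀ ℕ),
        (∀ c, (Finsupp.single a 1 + r : _ →₀ ℕ) c ≠ 0 → T a ≤ T c) →
        shape h0 (Finsupp.single a 1 + r) = shape h0 (Finsupp.single b 1 + r') →
        rank (shapeOf h0 a) ≤ rank (shapeOf h0 b) := by
      intro a b r r' ha h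
      have hne : shape h0 (Finsupp.single a 1 + r) (shapeOf h0 b) ≠ 0 := by
        rw [h]; simp
      obtain ⟨c, hc, hcb⟩ := exists_of_mapDomain_ne_zero hne
      rw [← hcb]
      exact hT _ _ (ha c hc)
    have hab : shapeOf h0 a = shapeOf h0 b :=
      hr (le_antisymm (key a b r r' ha hshape) (key b a r' r hb hshape.symm))
    have hexp' := hexp
    simp only [map_add, expHom_single, one_smul] at hexp'
    have hab' : a = b := Subtype.ext <| eq_of_precedes hexp' (congrArg Subtype.val hab)
      (hs.precedes fun c hc => ha c (by simp [hc])) (ht.precedes fun c hc => hb c (by simp [hc]))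
    subst hab'
    rw [map_add, map_add] at hshape hexp
    congr 1
    refine ih r r' ?_ (hs.mono le_add_self) (ht.mono le_add_self) (add_left_cancel hshape)
      (add_left_cancel hexp)
    rw [map_add, Finsupp.degree_single] at hn
    omega

/-- Two unsorted factors can be replaced by factors of the same multidegrees with values of `T`
further apart. -/
theorem exists_swap {V : (Var l →₀ ℕ) →+ ℕ} (hV : ∀ p, V (Finsupp.single p 1) = p.2)
    {ρ : A → ℕ} {a b : nestedConfiguration A (unitVec l)}
    (h : ¬ Precedes (a : Var l →₀ ℕ) b) : ∃ a' b' : nestedConfiguration A (unitVec l),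
      shapeOf h0 a' = shapeOf h0 a ∧ shapeOf h0 b' = shapeOf h0 b ∧ (a' : Var l →₀ ℕ) + b' = a + b ∧
      ∃ δ, 0 < δ ∧ ρ (shapeOf h0 a') + V a' + δ = ρ (shapeOf h0 a) + V a ∧
        ρ (shapeOf h0 b') + V b' = ρ (shapeOf h0 b) + V b + δ := by
  obtain ⟨a, haB⟩ := a
  obtain ⟨b, hbB⟩ := b
  simp only [Precedes, not_forall, not_le] at h
  obtain ⟨p, q, hpq, hp, hq, hlt⟩ := h
  obtain ⟨x, rfl⟩ := exists_add_of_le (Finsupp.single_le_iff.2 (Nat.one_le_iff_ne_zero.2 hp))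
  obtain ⟨y, rfl⟩ := exists_add_of_le (Finsupp.single_le_iff.2 (Nat.one_le_iff_ne_zero.2 hq))
  have h1 : mdeg l (Finsupp.single q 1 + x) = mdeg l (Finsupp.single p 1 + x) := by simp [hpq]
  have h2 : mdeg l (Finsupp.single p 1 + y) = mdeg l (Finsupp.single q 1 + y) := by simp [hpq]
  have h1' : Finsupp.single q 1 + x ∈ nestedConfiguration A (unitVec l) := by
    rw [mem_nestedConfiguration h0, h1]
    exact (mem_nestedConfiguration h0 _).1 haB
  have h2' : Finsupp.single p 1 + y ∈ nestedConfiguration A (unitVec l) := by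
    rw [mem_nestedConfiguration h0, h2]
    exact (mem_nestedConfiguration h0 _).1 hbB
  have e1 : shapeOf h0 ⟨_, h1'⟩ = shapeOf h0 ⟨_, haB⟩ := Subtype.ext h1
  have e2 : shapeOf h0 ⟨_, h2'⟩ = shapeOf h0 ⟨_, hbB⟩ := Subtype.ext h2
  -- Exchanging the offending variables `p` and `q` moves both index sums by their index difference.
  refine ⟨⟨_, h1'⟩, ⟨_, h2'⟩, e1, e2, by simp only; abel, (p.2 : ℕ) - q.2, by omega, ?_, ?_⟩
  · rw [e1]; simp only [map_add, hV]; omega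
  · rw [e2]; simp only [map_add, hV]; omega

end Sorted

/-! ### The term order for the nested configuration -/

section Order

variable {d : ℕ} {l : Fin d → ℕ} {A : Set (Fin d →₀ ℕ)} (h0 : 0 ∉ A)

/-- Some part of `s` of degree at most two is not minimal in its fibre. -/
def HasSmallerPart {σ : Type u} {A : Set (σ →₀ ℕ)} (m : MonomialOrder.{u, u} A) (s : A →₀ ℕ) :
    Prop :=
  ∃ e e' : A →₀ ℕ, e ≤ s ∧ e.degree ≤ 2 ∧ e'.degree ≤ 2 ∧ expHom A e' = expHom A e ∧ e' ≺[m] e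

/-- A term order on the nested configuration that compares products first, next the multidegrees of
the factors, and last how well the factors are sorted. -/
theorem exists_order_nestedConfiguration (hA : IsConfiguration A)
    (mI : MonomialOrder (Var l)) (mA : MonomialOrder A) :
    ∃ (m : MonomialOrder (nestedConfiguration A (unitVec l)))
      (T : nestedConfiguration A (unitVec l) → ℕ) (rank : A → ℕ),
      (∀ s t, expHom _ s ≺[mI] expHom _ t → s ≺[m] t) ∧
      (∀ s t, expHom _ s = expHom _ t → shape h0 s ≺[mA] shape h0 t → s ≺[m] t) ∧
      Function.Injective rank ∧
      (∀ a b, T a ≤ T b → rank (shapeOf h0 a) ≤ rank (shapeOf h0 b)) ∧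
      ∀ a b, T a ≤ T b → ¬ Precedes (a : Var l →₀ ℕ) b →
        HasSmallerPart m (Finsupp.single a 1 + Finsupp.single b 1) := by
  have hfin : Finite (nestedConfiguration A (unitVec l)) := finite_nestedConfiguration hA
  have hAfin : Finite A := hA.1
  obtain ⟨n, ⟨eqv⟩⟩ := Finite.exists_equiv_fin A
  set V : (Var l →₀ ℕ) →+ ℕ := Finsupp.weight fun p => (p.2 : ℕ)
  have hV : ∀ p, V (Finsupp.single p 1) = p.2 := fun p => by simp [V, Finsupp.weight_single]
  obtain ⟨bd, hbd⟩ := (Set.finite_range fun b : nestedConfiguration A (unitVec l) =>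
    V b).bddAbove
  replace hbd : ∀ b : nestedConfiguration A (unitVec l), V b ≤ bd := fun b => hbd ⟨b, rfl⟩
  -- Since `V` is at most `bd` on factors, blocks of length `bd + 1` make `T` compare ranks first
  -- and index sums second.
  set ρ : A → ℕ := fun a => (bd + 1) * (eqv a : ℕ) with hρ
  set T : nestedConfiguration A (unitVec l) → ℕ := fun b => ρ (shapeOf h0 b) + V b with hT
  obtain ⟨C, hC⟩ := (Set.finite_range fun b => T b ^ 2).bddAbove
  replace hC : ∀ b, T b ^ 2 ≤ C := fun b => hC ⟨b, rfl⟩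
  -- Spreading two values of `T` apart increases the sum of their squares, so it lowers this weight;
  -- `C` bounds every square, so the subtraction never truncates.
  set w : (nestedConfiguration A (unitVec l) →₀ ℕ) →+ ℕ :=
    Finsupp.weight fun b => C - T b ^ 2 with hw
  set m₃ := refineOrder w (someOrder _) (fun _ => Nat.zero_le _)
  set m₂ := refineOrder (mA.toSyn.toAddMonoidHom.comp (shape h0)) m₃ (fun _ => mA.zero_le _)
  set m₁ := refineOrder (mI.toSyn.toAddMonoidHom.comp (expHom _)) m₂ (fun _ => mI.zero_le _)
  refine ⟨m₁, T, fun a => eqv a, ?_, ?_, ?_, ?_, ?_⟩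
  · intro s t h
    rw [refineOrder_lt_iff]
    exact Or.inl h
  · intro s t h h'
    rw [refineOrder_lt_iff]
    refine Or.inr ⟨congrArg mI.toSyn h, ?_⟩
    rw [refineOrder_lt_iff]
    exact Or.inl h'
  · exact fun a b h => eqv.injective (Fin.ext h)
  · intro a b hab
    by_contra! hlt
    have h1 : (bd + 1) * ((eqv (shapeOf h0 b) : ℕ) + 1) ≤ (bd + 1) * (eqv (shapeOf h0 a) : ℕ) :=
      Nat.mul_le_mul_left _ hlt
    have h2 := hbd b
    simp only [hT, hρ] at hab
    rw [mul_add] at h1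
    omega
  · intro a b hab h
    obtain ⟨a', b', ha', hb', hsum, δ, hδ, h1, h2⟩ := exists_swap h0 hV (ρ := ρ) h
    refine ⟨_, Finsupp.single a' 1 + Finsupp.single b' 1, le_rfl, by simp, by simp,
      by simpa using hsum, ?_⟩
    rw [refineOrder_lt_iff]
    refine Or.inr ⟨congrArg mI.toSyn (by simpa using hsum), ?_⟩
    rw [refineOrder_lt_iff]
    refine Or.inr ⟨congrArg mA.toSyn (by simp [ha', hb']), ?_⟩
    rw [refineOrder_lt_iff]
    left
    change T a' + δ = T a at h1
    change T b' = T b + δ at h2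
    have hsq : T a ^ 2 + T b ^ 2 < T a' ^ 2 + T b' ^ 2 := by
      rw [h2]; rw [← h1] at hab ⊢; nlinarith
    simp only [hw, map_add, Finsupp.weight_single, one_smul]
    have := hC a
    have := hC b
    have := hC a'
    have := hC b'
    omega

/-- For a suitable term order, an exponent vector that is not minimal in its fibre has a part of
degree at most two that is not minimal either. -/
theorem exists_order_hasSmallerPart (hA : IsConfiguration A) (mI : MonomialOrder (Var l))
    (mA : MonomialOrder A)
    (hmA : ∀ s t : A →₀ ℕ, expHom A s = expHom A t → t ≺[mA] s → HasSmallerPart mA s) :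
    ∃ m : MonomialOrder (nestedConfiguration A (unitVec l)),
      (∀ s t, expHom _ s ≺[mI] expHom _ t → s ≺[m] t) ∧
      ∀ s t, expHom _ s = expHom _ t → t ≺[m] s → HasSmallerPart m s := by
  have h0 := hA.zero_notMem
  obtain ⟨m, T, rank, hm1, hm2, hrank, hT, hswap⟩ :=
    exists_order_nestedConfiguration h0 hA mI mA
  refine ⟨m, hm1, ?_⟩
  have hsorted : ∀ s, ¬ HasSmallerPart m s → IsSorted T s := by
    intro s hs a b hab hle
    by_contra h
    obtain ⟨e, e', h1, h2⟩ := hswap a b hle h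
    exact hs ⟨e, e', h1.trans hab, h2⟩
  have hshape : ∀ s, ¬ HasSmallerPart m s → ¬ HasSmallerPart mA (shape h0 s) := by
    -- Realize `e` by a part `f` of `s`, then refactor the product of `f` with shape `e'`: the
    -- product is unchanged and the shape decreases.
    rintro s hs ⟨e, e', hle, hd, hd', hexp, hlt⟩
    obtain ⟨f, hf, rfl⟩ := exists_le_mapDomain_eq e hle
    obtain ⟨f', rfl, hf'⟩ := exists_shape_eq h0 e' (expHom _ f)
      ((mdeg_expHom h0 f).trans hexp.symm)
    refine hs ⟨f, f', hf, ?_, ?_, hf', hm2 _ _ hf' hlt⟩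
    · rwa [degree_mapDomain] at hd
    · rwa [degree_shape] at hd'
  have huniq : ∀ s t, expHom _ s = expHom _ t → ¬ HasSmallerPart m s → ¬ HasSmallerPart m t →
      s = t := by
    intro s t hst hs ht
    have hexp : expHom A (shape h0 s) = expHom A (shape h0 t) := by
      rw [← mdeg_expHom, ← mdeg_expHom, hst]
    refine eq_of_isSorted h0 hrank hT _ s t rfl (hsorted s hs) (hsorted t ht) ?_ hst
    rcases lt_trichotomy (mA.toSyn (shape h0 s)) (mA.toSyn (shape h0 t)) with h | h | h
    · exact absurd (hmA _ _ hexp.symm h) (hshape t ht)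
    · exact mA.toSyn.injective h
    · exact absurd (hmA _ _ hexp h) (hshape s hs)
  intro s t hst hlt
  by_contra hs
  -- The minimum `r` of the fibre has no smaller part, since replacing one would lower `r`; by
  -- uniqueness it equals `s`, which `t` undercuts.
  obtain ⟨r, hr, hmin⟩ := (InvImage.wf m.toSyn wellFounded_lt).has_min
    {r | expHom _ r = expHom _ s} ⟨s, rfl⟩
  have hrp : ¬ HasSmallerPart m r := by
    rintro ⟨e, e', hle, -, -, hexp, hlt⟩
    obtain ⟨x, rfl⟩ := exists_add_of_le hle
    refine hmin (e' + x) ?_ ?_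
    · rw [Set.mem_ofPred_eq, ← hr, map_add, map_add, hexp]
    · simpa [InvImage] using hlt
  obtain rfl := huniq r s hr hrp hs
  exact hmin t hst.symm hlt

end Order

/-! ### Contraction ideals -/

section Contraction

variable {d : ℕ} {l : Fin d → ℕ} {A : Set (Fin d →₀ ℕ)} {K : Type v} [Field K]

/-- A multihomogeneous polynomial whose leading monomial is the product of the factors of `s` lifts
to a polynomial with leading monomial `s`. -/
theorem exists_lift (h0 : 0 ∉ A) {mI : MonomialOrder (Var l)}
    {m : MonomialOrder (nestedConfiguration A (unitVec l))}
    (hm : ∀ s t, expHom _ s ≺[mI] expHom _ t → s ≺[m] t) {h : MvPolynomial (Var l) K}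
    (hne : h ≠ 0) {s : nestedConfiguration A (unitVec l) →₀ ℕ} (hs : mI.degree h = expHom _ s)
    (hdeg : ∀ q ∈ h.support, mdeg l q = mdeg l (expHom _ s)) :
    ∃ H : MvPolynomial (nestedConfiguration A (unitVec l)) K, monomialHom K _ H = h ∧ H ≠ 0 ∧
      H.totalDegree ≤ s.degree ∧ m.degree H = s := by
  classical
  have hex : ∀ q, ∃ t, q ∈ h.support → shape h0 t = shape h0 s ∧ expHom _ t = q := fun q => by
    by_cases hq : q ∈ h.support
    · obtain ⟨t, ht⟩ := exists_shape_eq h0 (shape h0 s) q ((hdeg q hq).trans (mdeg_expHom h0 s))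
      exact ⟨t, fun _ => ht⟩
    · exact ⟨0, fun hq' => absurd hq' hq⟩
  choose ψ₀ hψ₀ using hex
  -- The lifts are arbitrary except at the leading exponent, which must lift to `s` itself.
  set ψ := Function.update ψ₀ (expHom _ s) s with hψdef
  have hψs : ψ (expHom _ s) = s := Function.update_self ..
  have hψ : ∀ q ∈ h.support, shape h0 (ψ q) = shape h0 s ∧ expHom _ (ψ q) = q := by
    intro q hq
    by_cases hqs : q = expHom _ s
    · subst hqs
      rw [hψs]
      exact ⟨rfl, rfl⟩
    · rw [hψdef, Function.update_of_ne hqs]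
      exact hψ₀ q hq
  set H : MvPolynomial (nestedConfiguration A (unitVec l)) K :=
    ∑ q ∈ h.support, monomial (ψ q) (coeff q h) with hH
  have hHh : monomialHom K _ H = h := by
    conv_rhs => rw [h.as_sum]
    rw [hH, map_sum]
    refine Finset.sum_congr rfl fun q hq => ?_
    rw [monomialHom_monomial, (hψ q hq).2]
  have hH0 : H ≠ 0 := by
    rintro h1
    rw [h1, map_zero] at hHh
    exact hne hHh.symm
  have hsupp : ∀ t ∈ H.support, ∃ q ∈ h.support, t = ψ q := by
    intro t ht
    rw [mem_support_iff, hH, coeff_sum] at ht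
    obtain ⟨q, hq, hqt⟩ := Finset.exists_ne_zero_of_sum_ne_zero ht
    refine ⟨q, hq, ?_⟩
    by_contra hne
    exact hqt (by rw [coeff_monomial, if_neg (Ne.symm hne)])
  have hsH : s ∈ H.support := by
    obtain ⟨t, ht, hts⟩ := exists_of_coeff_monomialHom_ne_zero (f := H) (e := expHom _ s) (by
      rw [hHh, ← hs]; exact mI.degree_mem_support hne)
    obtain ⟨q, hq, rfl⟩ := hsupp t ht
    rw [(hψ q hq).2] at hts
    rwa [hts, hψs] at ht
  refine ⟨H, hHh, hH0, ?_, ?_⟩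
  · refine Finset.sup_le fun t ht => ?_
    obtain ⟨q, hq, rfl⟩ := hsupp t ht
    change (ψ q).degree ≤ s.degree
    -- All lifts share the shape of `s`, hence its number of factors.
    rw [← degree_shape h0, (hψ q hq).1, degree_shape]
  · obtain ⟨q, hq, hqH⟩ := hsupp _ (m.degree_mem_support hH0)
    have hqs : q ≼[mI] expHom _ s := hs ▸ mI.le_degree hq
    rcases hqs.lt_or_eq with hlt | heq
    · have h1 := hm (ψ q) s (by rwa [(hψ q hq).2])
      rw [← hqH] at h1
      exact absurd (m.le_degree hsH) (not_le.2 h1)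
    · rw [hqH, mI.toSyn.injective heq, hψs]

/-- Leading monomials of a multigraded ideal with a quadratic Groebner basis, in the subring
generated by the nested configuration, come from factorizations into at most two factors. -/
theorem exists_mem_comap_of_degree_eq (h0 : 0 ∉ A) {mI : MonomialOrder (Var l)}
    {m : MonomialOrder (nestedConfiguration A (unitVec l))}
    (hm : ∀ s t, expHom _ s ≺[mI] expHom _ t → s ≺[m] t) {I : Ideal (MvPolynomial (Var l) K)}
    (hI : IsMultigraded I) {G : Set (MvPolynomial (Var l) K)} (hG : IsGroebnerBasis mI G I)
    (hG2 : ∀ g ∈ G, g.totalDegree ≤ 2) {F : MvPolynomial (Var l) K} (hF : F ∈ I) (hF0 : F ≠ 0)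
    {s : nestedConfiguration A (unitVec l) →₀ ℕ} (hs : mI.degree F = expHom _ s) :
    ∃ H ∈ I.comap (monomialHom K (nestedConfiguration A (unitVec l))),
      H ≠ 0 ∧ H.totalDegree ≤ 2 ∧ m.degree H ≤ s := by
  classical
  obtain ⟨g, hg, hg0, hgd⟩ := hG.exists_degree_le hF hF0
  set p := mI.degree g with hp
  have hpg : p ∈ g.support := mI.degree_mem_support hg0
  -- The element `g` need not be multihomogeneous, but its component in the multidegree of `p` stays
  -- in `I` and keeps the leading monomial `p`.
  set g' := weightedHomogeneousComponent (varDegree l) (mdeg l p) g with hg'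
  have hg'I : g' ∈ I := hI g (hG.2.1 hg) _
  have hcoeff : ∀ q, coeff q g' = if mdeg l q = mdeg l p then coeff q g else 0 := fun q => by
    rw [hg', coeff_weightedHomogeneousComponent, weight_varDegree]
  have hg'supp : ∀ q ∈ g'.support, mdeg l q = mdeg l p ∧ q ∈ g.support := by
    intro q hq
    rw [mem_support_iff, hcoeff] at hq
    split_ifs at hq with hqd
    · exact ⟨hqd, mem_support_iff.2 hq⟩
    · exact absurd rfl hq
  have hpg' : p ∈ g'.support := by
    rw [mem_support_iff, hcoeff, if_pos rfl]
    exact mem_support_iff.1 hpg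
  have hg'0 : g' ≠ 0 := by
    rintro h
    simp [h] at hpg'
  have hg'd : mI.degree g' = p :=
    mI.toSyn.injective <| le_antisymm
      (mI.le_degree (hg'supp _ (mI.degree_mem_support hg'0)).2) (mI.le_degree hpg')
  obtain ⟨t, hts, htd, hpt⟩ := exists_le_expHom_of_le p (hs ▸ hgd)
  obtain ⟨r, hr⟩ := exists_add_of_le hpt
  have hmon : (monomial r (1 : K)) ≠ 0 := by simp
  obtain ⟨H, hHh, hH0, hH2, hHd⟩ := exists_lift h0 hm (h := monomial r 1 * g') (s := t)
    (mul_ne_zero hmon hg'0) (by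
      rw [mI.degree_mul hmon hg'0, hg'd, MonomialOrder.degree_monomial, if_neg one_ne_zero, hr,
        add_comm]) (by
      intro q hq
      obtain ⟨x, hx, y, hy, rfl⟩ := Finset.mem_add.1 (support_mul _ _ hq)
      have hx' : x = r := by simpa using support_monomial_subset hx
      rw [hx', hr, map_add, map_add, (hg'supp y hy).1, add_comm])
  refine ⟨H, ?_, hH0, hH2.trans (htd.trans ((degree_le_totalDegree hpg).trans (hG2 g hg))),
    hHd ▸ hts⟩
  rw [Ideal.mem_comap, hHh]
  exact I.mul_mem_left _ hg'I

/-- A part that is not minimal in its fibre is the leading monomial of a binomial in the kernel. -/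
theorem HasSmallerPart.exists_mem_toricIdeal {σ : Type u} {B : Set (σ →₀ ℕ)}
    {m : MonomialOrder.{u, u} B} {s : B →₀ ℕ} (h : HasSmallerPart m s) :
    ∃ g ∈ toricIdeal K B, g ≠ 0 ∧ g.totalDegree ≤ 2 ∧ m.degree g ≤ s := by
  classical
  obtain ⟨e, e', hle, hd, hd', hexp, hlt⟩ := h
  have hne : e' ≠ e := by rintro rfl; exact lt_irrefl _ hlt
  refine ⟨monomial e 1 - monomial e' 1, ?_, ?_, ?_, ?_⟩
  · simp [toricIdeal, RingHom.mem_ker, monomialHom_monomial, hexp]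
  · intro h0
    have := congrArg (coeff e) h0
    simp [coeff_monomial, hne] at this
  · refine (totalDegree_sub _ _).trans (max_le ?_ ?_)
    · rw [totalDegree_monomial _ one_ne_zero]; exact hd
    · rw [totalDegree_monomial _ one_ne_zero]; exact hd'
  · rw [MonomialOrder.degree_sub_of_lt] <;> simp [MonomialOrder.degree_monomial, hlt, hle]

end Contraction

end NestedConfig

end

theorem mainTheorem5 {d : ℕ} (l : Fin d → ℕ) (K : Type v) [Field K]
    (A : Set (Fin d →₀ ℕ)) (hA : NestedConfig.IsConfiguration A)
    (I : Ideal (MvPolynomial (NestedConfig.Var l) K)) (hI : NestedConfig.IsMultigraded I)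
    (hIG : NestedConfig.AdmitsQuadraticGroebnerBasis I)
    (hAG : NestedConfig.AdmitsQuadraticGroebnerBasis (NestedConfig.toricIdeal K A)) :
    NestedConfig.AdmitsQuadraticGroebnerBasis
      (I.comap (NestedConfig.monomialHom K
        (NestedConfig.nestedConfiguration A (NestedConfig.unitVec l)))) := by
  have hfin : Finite (NestedConfig.nestedConfiguration A (NestedConfig.unitVec l)) :=
    NestedConfig.finite_nestedConfiguration hA
  obtain ⟨mA, hmA⟩ := NestedConfig.exists_order_of_toricIdeal hAG
  obtain ⟨mI, G, hG, hG2⟩ := hIG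
  obtain ⟨m, hm, hpart⟩ := NestedConfig.exists_order_hasSmallerPart hA mI mA hmA
  refine NestedConfig.admitsQuadraticGroebnerBasis_of_forall m _ fun f hf hf0 => ?_
  have hD := m.degree_mem_support hf0
  -- Either the image of the leading term cancels, and a kernel binomial serves, or it survives as
  -- the leading term of the image because `m` compares products first.
  by_cases hc : coeff (NestedConfig.expHom _ (m.degree f)) (NestedConfig.monomialHom K _ f) = 0
  · obtain ⟨t, ht, hne, hexp⟩ := NestedConfig.exists_ne_of_coeff_monomialHom_eq_zero hD hc
    have hlt : m.toSyn t < m.toSyn (m.degree f) :=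
      lt_of_le_of_ne (m.le_degree ht) fun h => hne (m.toSyn.injective h)
    obtain ⟨g, hg, hg'⟩ := (hpart _ t hexp.symm hlt).exists_mem_toricIdeal (K := K)
    refine ⟨g, ?_, hg'⟩
    rw [Ideal.mem_comap, show NestedConfig.monomialHom K _ g = 0 from hg]
    exact I.zero_mem
  · have hF0 : NestedConfig.monomialHom K _ f ≠ 0 := by
      intro h
      simp [h] at hc
    refine NestedConfig.exists_mem_comap_of_degree_eq hA.zero_notMem hm hI hG hG2
      (Ideal.mem_comap.1 hf) hF0 (mI.toSyn.injective (le_antisymm ?_ ?_))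
    · obtain ⟨t, ht, hexp⟩ :=
        NestedConfig.exists_of_coeff_monomialHom_ne_zero (mI.degree_mem_support hF0)
      rw [← hexp]
      by_contra! hlt
      exact absurd (m.le_degree ht) (not_le.2 (hm _ _ hlt))
    · exact mI.le_degree (mem_support_iff.2 hc)
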